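/- Let $H\in\mathbb{C}^{B\times U}$, $r\in\mathbb{C}^{B}$, $\alpha_1,\dots,\alpha_Q\ge 0$ and $\rho\in\mathbb{R}$. Let $\tilde{\mathcal X}^U=\{x\in\mathbb{C}^U : \mathrm{Re}\,x_u,\ \mathrm{Im}\,x_u\in[-1,1]\text{ for all }u\}$, let $\Pi$ be the projection of $\mathbb{C}^U$ onto $\tilde{\mathcal X}^U$ (entrywise clipping of real and imaginary parts to $[-1,1]$), and let $\ell(x)=\frac12\|r-Hx\|_2^2$. Consider the box-constrained penalized maximum-likelihood problem $$\min_{x_1,\dots,x_Q\in\tilde{\mathcal X}^U}\ F(x_1,\dots,x_Q):=\ell\Big(\sum_{q=1}^Q 2^{q-1}x_q\Big)-\sum_{q=1}^Q\frac{\alpha_q}{2}\|x_q\|_2^2 .$$ The PS-ADMM iterates are generated from an arbitrary starting point $x_1^1,\dots,x_Q^1,x_0^1,y^1\in\mathbb{C}^U$ (for instance all zeros) by setting, for $k=1,2,\dots$, successively for $q=1,\dots,Q$, $$x_q^{k+1}=\Pi\Big(\frac{2^{q-1}}{4^{q-1}\rho-\alpha_q}\Big(\rho x_0^k-\rho\sum_{i<q}2^{i-1}x_i^{k+1}-\rho\sum_{i>q}2^{i-1}x_i^{k}+y^k\Big)\Big),$$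 and then $$x_0^{k+1}=(H^HH+\rho I)^{-1}\Big(H^Hr+\rho\sum_{q=1}^Q2^{q-1}x_q^{k+1}-y^k\Big),\qquad y^{k+1}=y^k+\rho\Big(x_0^{k+1}-\sum_{q=1}^Q2^{q-1}x_q^{k+1}\Big).$$ Assume $4^{q-1}\rho>\alpha_q$ for $q=1,\dots,Q$ and $\rho>\sqrt2\,\lambda_{\max}(H^HH)$. Then the iterates converge: there are $x_1^*,\dots,x_Q^*,x_0^*,y^*\in\mathbb{C}^U$ with $x_q^k\to x_q^*$ for every $q$, $x_0^k\to x_0^*$ and $y^k\to y^*$ as $k\to\infty$, and $x_0^*=\sum_{q=1}^Q2^{q-1}x_q^*$. Moreover $(x_1^*,\dots,x_Q^*)$ is a stationary point of the problem above: $x_q^*\in\tilde{\mathcal X}^U$ for every $q$, and $$\mathrm{Re}\,\big\langle\nabla_{x_q}F(x_1^*,\dots,x_Q^*),\,x_q-x_q^*\big\rangle\ge0\qquad\text{for all }x_q\in\tilde{\mathcal X}^U,\ q=1,\dots,Q,$$ where $\nabla_{x_q}$ is the gradient in the block $x_q$ with respect to the real inner product $\mathrm{Re}\langle\cdot,\cdot\rangle$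 on $\mathbb{C}^U$. -/

import Mathlib

open Filter Topology

noncomputable section

namespace PSADMM

/-- The space `ℂ^n` of complex column vectors, with the 2-norm. -/
abbrev CVec (n : ℕ) : Type := EuclideanSpace ℂ (Fin n)

/-- The largest eigenvalue of a Hermitian matrix. -/
def lambdaMax {n : ℕ} {A : Matrix (Fin n) (Fin n) ℂ} (hA : A.IsHermitian) : ℝ :=
  ⨆ i, hA.eigenvalues i

/-- The box of vectors all of whose entries have real and imaginary part in `[-1, 1]`. -/
def box (U : ℕ) : Set (CVec U) :=
  {x | ∀ u, (x u).re ∈ Set.Icc (-1 : ℝ) 1 ∧ (x u).im ∈ Set.Icc (-1 : ℝ) 1}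

/-- Entrywise projection of real and imaginary parts onto `[-1, 1]`. -/
def boxProj {U : ℕ} (x : CVec U) : CVec U :=
  WithLp.toLp 2 fun u =>
    (⟨max (-1) (min 1 (x u).re), max (-1) (min 1 (x u).im)⟩ : ℂ)

/-- The weighted sum `∑_{q=1}^{Q} 2^{q-1} x_q`. The index `q : Fin Q` is zero-based, so that
the weight of the block `q` is `2 ^ q`. -/
def weightedSum {U Q : ℕ} (x : Fin Q → CVec U) : CVec U :=
  ∑ q : Fin Q, (2 : ℝ) ^ (q : ℕ) • x q

/-- The least-squares loss `ℓ(x) = ½ ‖r - H x‖²`. -/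
def loss {B U : ℕ} (H : Matrix (Fin B) (Fin U) ℂ) (r : CVec B) (x : CVec U) : ℝ :=
  1 / 2 * ‖r - H.toEuclideanLin x‖ ^ 2

/-- The penalized objective `ℓ(∑ 2^{q-1} x_q) - ∑ (α_q / 2) ‖x_q‖²`. -/
def objective {B U Q : ℕ} (H : Matrix (Fin B) (Fin U) ℂ) (r : CVec B) (α : Fin Q → ℝ)
    (x : Fin Q → CVec U) : ℝ :=
  loss H r (weightedSum x) - ∑ q, α q / 2 * ‖x q‖ ^ 2

/-- Stationary points of the problem of minimizing `objective` subject to `x_q ∈ box` for every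
`q`: feasible points at which, for each block `q`, the gradient `g` in the block variable `x_q`
(`ℂ^U` carrying the real inner product `Re ⟪·, ·⟫`) satisfies the variational inequality
`Re ⟪g, v - x_q⟫ ≥ 0` for every `v` in the box. -/
def IsStationary {B U Q : ℕ} (H : Matrix (Fin B) (Fin U) ℂ) (r : CVec B) (α : Fin Q → ℝ)
    (x : Fin Q → CVec U) : Prop :=
  (∀ q, x q ∈ box U) ∧
    ∀ q, ∃ g : CVec U,
      HasGradientAt (fun z : CVec U => objective H r α (Function.update x q z)) g (x q) ∧
        ∀ v ∈ box U, 0 ≤ (inner ℂ g (v - x q)).re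

/-- The sequences `x^k = (x_q^k)_q`, `x_0^k`, `y^k` are generated by PS-ADMM from some starting
point, which is stored at `k = 0`. The blocks are updated one after the other: the update of the
block `q` uses the new values of the blocks before `q` and the old values of those after `q`. -/
structure IsPSADMM {B U Q : ℕ} (H : Matrix (Fin B) (Fin U) ℂ) (r : CVec B) (ρ : ℝ)
    (α : Fin Q → ℝ) (x : ℕ → Fin Q → CVec U) (x₀ y : ℕ → CVec U) : Prop where
  x_step : ∀ k q, x (k + 1) q =
    boxProj (((2 : ℝ) ^ (q : ℕ) / (4 ^ (q : ℕ) * ρ - α q)) •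
      (ρ • x₀ k - ρ • ∑ i ∈ Finset.Iio q, (2 : ℝ) ^ (i : ℕ) • x (k + 1) i
        - ρ • ∑ i ∈ Finset.Ioi q, (2 : ℝ) ^ (i : ℕ) • x k i + y k))
  x₀_step : ∀ k, x₀ (k + 1) =
    ((H.conjTranspose * H + (ρ : ℂ) • (1 : Matrix (Fin U) (Fin U) ℂ))⁻¹).toEuclideanLin
      (H.conjTranspose.toEuclideanLin r + ρ • weightedSum (x (k + 1)) - y k)
  y_step : ∀ k, y (k + 1) = y k + ρ • (x₀ (k + 1) - weightedSum (x (k + 1)))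

end PSADMM

end

/-!
Write `s = ∑ ω_q x_q` with `ω_q = 2^(q-1)` and `G = HᴴH`. From the first iteration on, the `x_0`-
and `y`-steps together give `y^k = Hᴴ(r - H x_0^k)`, so that the multiplier is a function of `x_0`
and `y^{k+1} - y^k = -G (x_0^{k+1} - x_0^k)`. The proof has three ingredients.

*Descent.* Every block update minimizes the augmented Lagrangian `L`, a strongly convex quadratic
in the block because `4^(q-1) ρ > α_q`, over the box; the `x_0`-step lowers `L` by at least
`ρ/2 ‖x_0^{k+1} - x_0^k‖²`, and the multiplier step raises it by `‖y^{k+1} - y^k‖² / ρ`, at most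
`λ_max² / ρ ‖x_0^{k+1} - x_0^k‖²`. As `ρ > √2 λ_max`, `L` decreases by a multiple of `N_k²`, where
`N_k = ‖x^{k+1} - x^k‖ + ‖x_0^{k+1} - x_0^k‖` (`ADMMStep.primal_descent`,
`ADMMStep.slack_descent`). Along the iterates `L` is at least the objective `F`, hence bounded below
on the box, and `L - F` is `O(N_k²)` after the step (`augLagrangian_eq`).

*A Łojasiewicz inequality on faces.* For a quadratic function on an affine subspace, the critical
points form an affine subspace on which the function takes one value `c`, and where the gradient is
at most `ε`, small enough, the function differs from `c` by `O(ε²)`; if there is no critical point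
the gradient stays away from `0` (`quadratic_gap_le_sq_gradient_on_affine`). The box has finitely
many faces, and the optimality condition of the block updates says that the gradient of `F` along
the face that carries `x^{k+1}` is `O(N_k)`. Only finitely many values `c` occur, and `F(x^k)`
converges, so eventually `F(x^{k+1}) - lim F = O(N_k²)`
(`eventually_penalizedObjective_gap_le`). No error bound of Hoffman type is needed, since the
critical points on the affine hull of a face need not lie in the box.

*Finite length.* Descent and the gap estimate make `L - lim L` decay geometrically, so `∑ N_k`
converges (`summable_of_descent`) and the iterates form a Cauchy sequence. The variational
inequalities of the block updates pass to the limit and become stationarity (`admm_converges`).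

The analysis is carried out for a linear map `T` with adjoint `S` between real inner product
spaces, arbitrary weights `ω`, and a closed bounded set `C` with a projection `P` that has finitely
many faces; `ℂ^U` enters through its real inner product `Re ⟪·, ·⟫`.
-/

open scoped InnerProductSpace

noncomputable section

namespace PSADMM

/-! ### The Łojasiewicz inequality for quadratic functions -/

/-- Every value of `A` has a preimage of norm at most a fixed multiple of the norm of the value,
because `A` has a linear section over its range. -/
theorem exists_bounded_preimage {V W : Type*} [NormedAddCommGroup V] [NormedSpace ℝ V]
    [FiniteDimensional ℝ V] [NormedAddCommGroup W] [NormedSpace ℝ W] [FiniteDimensional ℝ W]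
    (A : V →ₗ[ℝ] W) :
    ∃ K : ℝ, 0 ≤ K ∧ ∀ w, ∃ u, A u = A w ∧ ‖u‖ ≤ K * ‖A w‖ := by
  obtain ⟨G, hG⟩ := A.rangeRestrict.exists_rightInverse_of_surjective A.range_rangeRestrict
  obtain ⟨K, hK0, hK⟩ := (LinearMap.toContinuousLinearMap G).bound
  refine ⟨K, hK0.le, fun w => ⟨G (A.rangeRestrict w), ?_, hK _⟩⟩
  have := congrArg (fun f => ((f (A.rangeRestrict w) : LinearMap.range A) : W)) hG
  simpa using this

/-- A Łojasiewicz inequality with exponent `1/2`: where its gradient `b + A v` is small, a quadratic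
function is within a multiple of the squared gradient norm of its critical value `c₀`. Without
critical points the gradient is bounded away from `0`, and the claim is vacuous for small `δ`. -/
theorem quadratic_gap_le_sq_gradient {V : Type*} [NormedAddCommGroup V] [NormedSpace ℝ V]
    [FiniteDimensional ℝ V] (c : ℝ) (b : V →L[ℝ] ℝ) (A : V →ₗ[ℝ] (V →L[ℝ] ℝ))
    (hA : ∀ v w, A v w = A w v) :
    ∃ c₀ κ δ : ℝ, 0 ≤ κ ∧ 0 < δ ∧ ∀ v, ‖b + A v‖ < δ →
      |c + b v + 1 / 2 * A v v - c₀| ≤ κ * ‖b + A v‖ ^ 2 := by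
  by_cases hb : -b ∈ LinearMap.range A
  · obtain ⟨v₀, hv₀⟩ := hb
    obtain ⟨K, hK0, hK⟩ := exists_bounded_preimage A
    refine ⟨c + b v₀ + 1 / 2 * A v₀ v₀, K, 1, hK0, one_pos, fun v _ => ?_⟩
    have hb : b = -A v₀ := by rw [hv₀, neg_neg]
    set w := v - v₀ with hw
    have hv : v = v₀ + w := by simp [hw]
    have hgrad : b + A v = A w := by rw [hb, hv, map_add]; abel
    have hval : c + b v + 1 / 2 * A v v - (c + b v₀ + 1 / 2 * A v₀ v₀) = 1 / 2 * A w w := by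
      rw [hb, hv]
      simp only [map_add, add_apply, neg_apply]
      rw [hA w v₀]; ring
    obtain ⟨u, hAu, h1⟩ := hK w
    -- `A w w` depends on `A w` only
    have hww : A w w = A w u := by rw [← hAu, hA u w, hAu]
    have h2 : |A w u| ≤ ‖A w‖ * ‖u‖ := (A w).le_opNorm u
    have h3 : ‖A w‖ * ‖u‖ ≤ ‖A w‖ * (K * ‖A w‖) := by gcongr
    rw [hgrad, hval, hww, abs_mul]
    have : |(1 / 2 : ℝ)| = 1 / 2 := by norm_num
    rw [this]
    nlinarith [abs_nonneg (A w u)]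
  · have hcl : IsClosed (LinearMap.range A : Set (V →L[ℝ] ℝ)) :=
      Submodule.closed_of_finiteDimensional _
    obtain ⟨δ, hδ, hball⟩ := Metric.isOpen_iff.1 hcl.isOpen_compl (-b) hb
    refine ⟨0, 0, δ, le_rfl, hδ, fun v hv => absurd (LinearMap.mem_range_self A v) ?_⟩
    refine hball ?_
    rw [Metric.mem_ball, dist_eq_norm, sub_neg_eq_add, add_comm]
    exact hv

/-- The Łojasiewicz inequality for the restriction of a quadratic function to the affine subspace
`p + V`; only the gradient along `V` has to be small. -/
theorem quadratic_gap_le_sq_gradient_on_affine {E : Type*} [NormedAddCommGroup E] [NormedSpace ℝ E]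
    [FiniteDimensional ℝ E] (c : ℝ) (b : E →ₗ[ℝ] ℝ) (A : E →ₗ[ℝ] E →ₗ[ℝ] ℝ)
    (hA : ∀ v w, A v w = A w v) (p : E) (V : Submodule ℝ E) :
    ∃ c₀ κ δ : ℝ, 0 ≤ κ ∧ 0 < δ ∧ ∀ z, z - p ∈ V → ∀ ε, 0 ≤ ε → ε < δ →
      (∀ w ∈ V, |b w + A z w| ≤ ε * ‖w‖) →
      |c + b z + 1 / 2 * A z z - c₀| ≤ κ * ε ^ 2 := by
  let A' : V →ₗ[ℝ] (V →L[ℝ] ℝ) :=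
    (LinearMap.toContinuousLinearMap (𝕜 := ℝ) (E := V) (F' := ℝ)).toLinearMap ∘ₗ
      (LinearMap.lcomp ℝ ℝ V.subtype ∘ₗ A ∘ₗ V.subtype)
  let b' : V →L[ℝ] ℝ := LinearMap.toContinuousLinearMap ((b + A p) ∘ₗ V.subtype)
  obtain ⟨c₀, κ, δ, hκ, hδ, h⟩ := quadratic_gap_le_sq_gradient (c + b p + 1 / 2 * A p p) b' A'
    (fun v w => hA v w)
  refine ⟨c₀, κ, δ, hκ, hδ, fun z hz ε hε hεδ hw => ?_⟩
  have hn : ‖b' + A' ⟨z - p, hz⟩‖ ≤ ε := by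
    refine ContinuousLinearMap.opNorm_le_bound _ hε fun w => ?_
    have : (b' + A' ⟨z - p, hz⟩) w = b w + A z w := by
      simp [b', A']
    rw [this]
    exact hw w w.2
  have h1 := h ⟨z - p, hz⟩ (hn.trans_lt hεδ)
  have h2 : c + b p + 1 / 2 * A p p + b' ⟨z - p, hz⟩ + 1 / 2 * A' ⟨z - p, hz⟩ ⟨z - p, hz⟩
      = c + b z + 1 / 2 * A z z := by
    have e1 : b' ⟨z - p, hz⟩ = b (z - p) + A p (z - p) := rfl
    have e2 : A' ⟨z - p, hz⟩ ⟨z - p, hz⟩ = A (z - p) (z - p) := rfl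
    rw [e1, e2]
    simp only [map_sub, LinearMap.sub_apply]
    rw [hA z p]; ring
  rw [h2] at h1
  exact h1.trans (by gcongr)

/-! ### Sequences with sufficient decrease -/

/-- If the decrease of `a` dominates `N²` and the gap of `a` to its lower bound `l` is in turn
dominated by `N²`, then `a - l` decays geometrically, and so does `N`. -/
theorem summable_of_descent {a N : ℕ → ℝ} {l c K : ℝ} (hc : 0 < c) (hK : 0 ≤ K)
    (hN : ∀ k, 0 ≤ N k) (hdec : ∀ k, c * N k ^ 2 ≤ a k - a (k + 1)) (hl : ∀ k, l ≤ a k)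
    (hgap : ∀ᶠ k in atTop, a (k + 1) - l ≤ K * N k ^ 2) : Summable N := by
  obtain ⟨n, hn⟩ := eventually_atTop.1 hgap
  set θ := K / (K + c) with hθ
  have hKc : 0 < K + c := by linarith
  have hθ0 : 0 ≤ θ := by positivity
  have hθ1 : θ < 1 := by rw [hθ, div_lt_one hKc]; linarith
  have hstep : ∀ k, n ≤ k → a (k + 1) - l ≤ θ * (a k - l) := by
    intro k hk
    have h1 := hn k hk
    have h2 := hdec k
    rw [hθ, div_mul_eq_mul_div, le_div_iff₀ hKc]
    nlinarith
  have hgeo : ∀ j, a (n + j) - l ≤ (a n - l) * θ ^ j := by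
    intro j
    induction j with
    | zero => simp
    | succ j ih =>
      have := hstep (n + j) (by omega)
      calc a (n + (j + 1)) - l ≤ θ * (a (n + j) - l) := this
        _ ≤ θ * ((a n - l) * θ ^ j) := by gcongr
        _ = _ := by ring
  have hbound : ∀ j, N (n + j) ≤ √((a n - l) / c) * √θ ^ j := by
    intro j
    have h1 := hdec (n + j)
    have h2 := hl (n + j + 1)
    have h3 := hgeo j
    have h0 : 0 ≤ (a n - l) / c := div_nonneg (by linarith [hl n]) hc.le
    refine abs_le_of_sq_le_sq' ?_ (by positivity) |>.2
    rw [mul_pow, Real.sq_sqrt h0, ← pow_mul, mul_comm j 2, pow_mul, Real.sq_sqrt hθ0,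
      div_mul_eq_mul_div, le_div_iff₀ hc]
    linarith
  have hsum : Summable fun j => N (n + j) :=
    Summable.of_nonneg_of_le (fun j => hN _) hbound
      ((summable_geometric_of_lt_one (Real.sqrt_nonneg _)
        (by rw [Real.sqrt_lt' one_pos]; simpa using hθ1)).mul_left _)
  refine (summable_nat_add_iff n).1 ?_
  simpa [add_comm] using hsum

/-! ### One iteration of the algorithm -/

/-- The weighted sum `∑ ω_q x_q` of the blocks, as a linear map. The space `Fin Q → X` carries the
sup norm; which norm is used on it is immaterial. -/
def blockSum {X : Type*} [NormedAddCommGroup X] [InnerProductSpace ℝ X] {Q : ℕ} (ω : Fin Q → ℝ) :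
    (Fin Q → X) →ₗ[ℝ] X :=
  ∑ q, ω q • LinearMap.proj q

/-- The weighted sum in which the blocks before `j` are those of `x'` and the remaining ones those
of `x`: the state of the Gauss–Seidel sweep from `x` to `x'` after `j` block updates. -/
def mixedSum {X : Type*} [NormedAddCommGroup X] [InnerProductSpace ℝ X] {Q : ℕ} (ω : Fin Q → ℝ)
    (x x' : Fin Q → X) (j : ℕ) : X :=
  blockSum ω fun i => if (i : ℕ) < j then x' i else x i

/-- The penalized objective `F(x) = ½ ‖r - T s‖² - ∑ (α_q / 2) ‖x_q‖²`, `s` being the weighted sum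
of the blocks of `x`. -/
def penalizedObjective {X Y : Type*} [NormedAddCommGroup X] [InnerProductSpace ℝ X]
    [NormedAddCommGroup Y] [InnerProductSpace ℝ Y] {Q : ℕ} (T : X →ₗ[ℝ] Y) (r : Y)
    (ω α : Fin Q → ℝ) (x : Fin Q → X) : ℝ :=
  1 / 2 * ‖r - T (blockSum ω x)‖ ^ 2 - ∑ q, α q / 2 * ‖x q‖ ^ 2

/-- The augmented Lagrangian for the splitting `z = ∑ ω_q x_q`, with multiplier `y` and penalty
parameter `ρ`. -/
def augLagrangian {X Y : Type*} [NormedAddCommGroup X] [InnerProductSpace ℝ X]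
    [NormedAddCommGroup Y] [InnerProductSpace ℝ Y] {Q : ℕ} (T : X →ₗ[ℝ] Y) (r : Y)
    (ω α : Fin Q → ℝ) (ρ : ℝ) (x : Fin Q → X) (z y : X) : ℝ :=
  1 / 2 * ‖r - T z‖ ^ 2 - ∑ q, α q / 2 * ‖x q‖ ^ 2 + ⟪y, z - blockSum ω x⟫_ℝ
    + ρ / 2 * ‖z - blockSum ω x‖ ^ 2

/-- One iteration leads from `(x, z, y)` to `(x', z', y')`. Here `S` plays the role of the adjoint
of `T`, and `P` that of the projection onto the constraint set; the `z`-step is written as a linear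
equation instead of with an inverse. -/
structure ADMMStep {X Y : Type*} [NormedAddCommGroup X] [InnerProductSpace ℝ X]
    [NormedAddCommGroup Y] [InnerProductSpace ℝ Y] {Q : ℕ} (T : X →ₗ[ℝ] Y) (S : Y →ₗ[ℝ] X) (r : Y)
    (ω α : Fin Q → ℝ) (ρ : ℝ) (P : X → X) (x x' : Fin Q → X) (z z' y y' : X) : Prop where
  x_step : ∀ q, x' q = P ((ω q / (ω q ^ 2 * ρ - α q)) •
    (ρ • z - ρ • ∑ i ∈ Finset.Iio q, ω i • x' i - ρ • ∑ i ∈ Finset.Ioi q, ω i • x i + y))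
  z_step : S (T z') + ρ • z' = S r + ρ • blockSum ω x' - y
  y_step : y' = y + ρ • (z' - blockSum ω x')

/-- Minus the partial gradient of the augmented Lagrangian in the block `q`, at the point reached
when that block has just been updated. It lies in the normal cone of the constraint set at `x' q`. -/
def blockNormal {X : Type*} [NormedAddCommGroup X] [InnerProductSpace ℝ X] {Q : ℕ}
    (ω α : Fin Q → ℝ) (ρ : ℝ) (x x' : Fin Q → X) (z y : X) (q : Fin Q) : X :=
  ω q • (ρ • (z - mixedSum ω x x' (q + 1)) + y) + α q • x' q

section

variable {X Y : Type*} [NormedAddCommGroup X] [InnerProductSpace ℝ X]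
  [NormedAddCommGroup Y] [InnerProductSpace ℝ Y] {Q : ℕ} {T : X →ₗ[ℝ] Y} {S : Y →ₗ[ℝ] X} {r : Y}
  {ω α : Fin Q → ℝ} {ρ lam : ℝ} {P : X → X} {C : Set X} {x x' : Fin Q → X} {z z' y y' : X}

theorem blockSum_apply (ω : Fin Q → ℝ) (x : Fin Q → X) : blockSum ω x = ∑ q, ω q • x q := by
  simp [blockSum]

theorem mixedSum_zero : mixedSum ω x x' 0 = blockSum ω x := by simp [mixedSum]

theorem mixedSum_all : mixedSum ω x x' Q = blockSum ω x' := by simp [mixedSum]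

theorem mixedSum_succ_sub (q : Fin Q) :
    mixedSum ω x x' (q + 1) - mixedSum ω x x' q = ω q • (x' q - x q) := by
  rw [mixedSum, mixedSum, ← map_sub, blockSum_apply, Finset.sum_eq_single q]
  · simp
  · intro i _ hi
    have : (i : ℕ) ≠ q := fun h => hi (Fin.ext h)
    have h2 : ((i : ℕ) < q + 1) ↔ (i : ℕ) < q := by omega
    simp only [Pi.sub_apply, h2, sub_self, smul_zero]
  · simp

theorem mixedSum_succ (q : Fin Q) :
    mixedSum ω x x' (q + 1) = ∑ i ∈ Finset.Iio q, ω i • x' i + ω q • x' q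
      + ∑ i ∈ Finset.Ioi q, ω i • x i := by
  have h : ∀ f : Fin Q → X,
      ∑ i, f i = ∑ i ∈ Finset.Iio q, f i + f q + ∑ i ∈ Finset.Ioi q, f i := by
    intro f
    rw [← Finset.sum_filter_add_sum_filter_not Finset.univ (fun i => i ≤ q)]
    have h1 : Finset.univ.filter (fun i => i ≤ q) = Finset.Iic q := by ext; simp
    have h2 : Finset.univ.filter (fun i => ¬ i ≤ q) = Finset.Ioi q := by ext; simp
    rw [h1, h2, ← Finset.sum_Iio_add_eq_sum_Iic]
  rw [mixedSum, blockSum_apply, h]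
  congr 1
  · congr 1
    · refine Finset.sum_congr rfl fun i hi => ?_
      have : (i : ℕ) < q := Fin.lt_def.1 (Finset.mem_Iio.1 hi)
      rw [if_pos (by omega)]
    · rw [if_pos (by omega)]
  · refine Finset.sum_congr rfl fun i hi => ?_
    have : (q : ℕ) < i := Fin.lt_def.1 (Finset.mem_Ioi.1 hi)
    rw [if_neg (by omega)]

theorem norm_blockSum_le (x : Fin Q → X) : ‖blockSum ω x‖ ≤ (∑ q, |ω q|) * ‖x‖ := by
  rw [blockSum_apply, Finset.sum_mul]
  refine (norm_sum_le _ _).trans (Finset.sum_le_sum fun q _ => ?_)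
  rw [norm_smul, Real.norm_eq_abs]
  gcongr
  exact norm_le_pi_norm x q

theorem norm_blockSum_sub_mixedSum_le (j : ℕ) :
    ‖blockSum ω x' - mixedSum ω x x' j‖ ≤ (∑ q, |ω q|) * ‖x' - x‖ := by
  rw [mixedSum, ← map_sub]
  refine (norm_blockSum_le _).trans ?_
  gcongr
  refine (pi_norm_le_iff_of_nonneg (norm_nonneg _)).2 fun i => ?_
  by_cases h : (i : ℕ) < j
  · simp [h]
  · simpa [h] using norm_le_pi_norm (x' - x) i

/-- The update of block `q` projects a point `u`, and the normal vector is a positive multiple of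
`u - P u`. -/
theorem ADMMStep.blockNormal_eq (h : ADMMStep T S r ω α ρ P x x' z z' y y')
    (hβ : ∀ q, 0 < ω q ^ 2 * ρ - α q) (q : Fin Q) :
    ∃ u, x' q = P u ∧ blockNormal ω α ρ x x' z y q = (ω q ^ 2 * ρ - α q) • (u - x' q) := by
  refine ⟨_, h.x_step q, ?_⟩
  rw [smul_sub, smul_smul, mul_div_cancel₀ _ (hβ q).ne', blockNormal, mixedSum_succ]
  module

theorem ADMMStep.inner_blockNormal_nonpos (h : ADMMStep T S r ω α ρ P x x' z z' y y')
    (hβ : ∀ q, 0 < ω q ^ 2 * ρ - α q) (hP : ∀ w, ∀ v ∈ C, ⟪w - P w, v - P w⟫_ℝ ≤ 0) (q : Fin Q)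
    {v : X} (hv : v ∈ C) : ⟪blockNormal ω α ρ x x' z y q, v - x' q⟫_ℝ ≤ 0 := by
  obtain ⟨u, hu, hn⟩ := h.blockNormal_eq hβ q
  rw [hn, real_inner_smul_left]
  refine mul_nonpos_of_nonneg_of_nonpos (hβ q).le ?_
  rw [hu]
  exact hP u v hv

/-- After a step the multiplier is minus the gradient of the least-squares loss at `z'`. -/
theorem ADMMStep.y_eq (h : ADMMStep T S r ω α ρ P x x' z z' y y') : y' = S (r - T z') := by
  have h1 := h.z_step
  rw [h.y_step, map_sub]
  have : y = S r + ρ • blockSum ω x' - (S (T z') + ρ • z') := by rw [h1]; abel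
  rw [this, smul_sub]; abel

/-- The change `y' - y = ρ (z' - ∑ ω_q x'_q)` of the multiplier, for a step from a point at which
`y` is already minus the gradient of the loss. -/
theorem ADMMStep.dual_sub (h : ADMMStep T S r ω α ρ P x x' z z' y y') (hy : y = S (r - T z)) :
    ρ • (z' - blockSum ω x') = -S (T (z' - z)) := by
  have h1 : ρ • (z' - blockSum ω x') = y' - y := by rw [h.y_step]; abel
  rw [h1, h.y_eq, hy]
  simp only [map_sub]; abel

/-- The sweep through the blocks decreases the augmented Lagrangian. -/
theorem ADMMStep.primal_descent (h : ADMMStep T S r ω α ρ P x x' z z' y y')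
    (hβ : ∀ q, 0 < ω q ^ 2 * ρ - α q) (hP : ∀ w, ∀ v ∈ C, ⟪w - P w, v - P w⟫_ℝ ≤ 0)
    (hx : ∀ q, x q ∈ C) :
    augLagrangian T r ω α ρ x' z y + ∑ q, (ω q ^ 2 * ρ - α q) / 2 * ‖x' q - x q‖ ^ 2
      ≤ augLagrangian T r ω α ρ x z y := by
  set φ : ℕ → ℝ := fun j => ⟪y, z - mixedSum ω x x' j⟫_ℝ + ρ / 2 * ‖z - mixedSum ω x x' j‖ ^ 2
    with hφ
  -- the variational inequality of block `q`, tested with the old value `x q`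
  have hstep : ∀ q : Fin Q, φ (q + 1) - φ q - α q / 2 * ‖x' q‖ ^ 2 + α q / 2 * ‖x q‖ ^ 2
      + (ω q ^ 2 * ρ - α q) / 2 * ‖x' q - x q‖ ^ 2 ≤ 0 := by
    intro q
    have h1 := h.inner_blockNormal_nonpos hβ hP q (hx q)
    set d := x' q - x q with hd
    have e1 : z - mixedSum ω x x' q = (z - mixedSum ω x x' (q + 1)) + ω q • d := by
      rw [hd, ← mixedSum_succ_sub q]; abel
    have e2 : x q = x' q - d := by rw [hd]; abel
    have e3 : x q - x' q = -d := by rw [hd]; abel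
    rw [e3, blockNormal] at h1
    simp only [hφ]
    rw [e1, e2]
    set t := z - mixedSum ω x x' (q + 1)
    simp only [inner_add_left, inner_neg_right, real_inner_smul_left] at h1
    rw [norm_add_sq_real, norm_sub_sq_real (x' q) d, norm_smul, inner_add_right,
      real_inner_smul_right, real_inner_smul_right, mul_pow, Real.norm_eq_abs, sq_abs]
    linarith
  have hsum : ∑ q : Fin Q, (φ (q + 1) - φ q) = φ Q - φ 0 := by
    rw [Fin.sum_univ_eq_sum_range (fun j => φ (j + 1) - φ j), Finset.sum_range_sub]
  have hle := Finset.sum_nonpos fun q (_ : q ∈ Finset.univ) => hstep q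
  simp only [Finset.sum_add_distrib, Finset.sum_sub_distrib] at hle hsum
  have hQ : φ Q = ⟪y, z - blockSum ω x'⟫_ℝ + ρ / 2 * ‖z - blockSum ω x'‖ ^ 2 := by
    simp only [hφ, mixedSum_all]
  have h0 : φ 0 = ⟪y, z - blockSum ω x⟫_ℝ + ρ / 2 * ‖z - blockSum ω x‖ ^ 2 := by
    simp only [hφ, mixedSum_zero]
  rw [augLagrangian, augLagrangian]
  linarith

/-- The updates of `z` and `y` together decrease the augmented Lagrangian as soon as
`ρ² > 2 lam²`. -/
theorem ADMMStep.slack_descent (hadj : ∀ x y, ⟪T x, y⟫_ℝ = ⟪x, S y⟫_ℝ)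
    (h : ADMMStep T S r ω α ρ P x x' z z' y y') (hy : y = S (r - T z)) (hρ : 0 < ρ)
    (hlam : ∀ v, ‖S (T v)‖ ≤ lam * ‖v‖) :
    augLagrangian T r ω α ρ x' z' y' + (ρ / 2 - lam ^ 2 / ρ) * ‖z' - z‖ ^ 2
      ≤ augLagrangian T r ω α ρ x' z y := by
  have hdual := h.dual_sub hy
  have hyy : y' = y - S (T (z' - z)) := by rw [h.y_step, hdual]; abel
  have hy0 : y = S (r - T z') - ρ • (z' - blockSum ω x') := by
    rw [← h.y_eq, h.y_step]; abel
  set d := z' - z with hd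
  set e := z' - blockSum ω x' with he
  have hz : z - blockSum ω x' = e - d := by rw [he, hd]; abel
  have hT : r - T z = (r - T z') + T d := by rw [hd, map_sub]; abel
  have hG : ‖S (T d)‖ ^ 2 ≤ lam ^ 2 * ‖d‖ ^ 2 := by
    rw [← mul_pow]; exact pow_le_pow_left₀ (norm_nonneg _) (hlam d) 2
  have hee : ⟪S (T d), e⟫_ℝ = -(‖S (T d)‖ ^ 2 / ρ) := by
    have : e = ρ⁻¹ • -S (T d) := by rw [← hdual, inv_smul_smul₀ hρ.ne']
    rw [this, real_inner_smul_right, inner_neg_right, real_inner_self_eq_norm_sq]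
    field_simp
  have hyd : ⟪y, d⟫_ℝ = ⟪r - T z', T d⟫_ℝ - ρ * ⟪e, d⟫_ℝ := by
    rw [hy0, inner_sub_left, real_inner_smul_left, real_inner_comm, ← hadj, real_inner_comm]
  have hdiv : ‖S (T d)‖ ^ 2 / ρ ≤ lam ^ 2 / ρ * ‖d‖ ^ 2 := by
    rw [div_mul_eq_mul_div]; gcongr
  rw [augLagrangian, augLagrangian, ← he, hz, hT, hyy, inner_sub_left, inner_sub_right y e,
    hee, hyd, norm_add_sq_real, norm_sub_sq_real e]
  nlinarith [sq_nonneg ‖T d‖]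

/-- When `y` is minus the gradient of the loss at `z`, the augmented Lagrangian differs from the
objective by a quadratic form in the constraint violation. -/
theorem augLagrangian_eq (hadj : ∀ x y, ⟪T x, y⟫_ℝ = ⟪x, S y⟫_ℝ) :
    augLagrangian T r ω α ρ x z (S (r - T z)) = penalizedObjective T r ω α x
      + ρ / 2 * ‖z - blockSum ω x‖ ^ 2 - 1 / 2 * ‖T (z - blockSum ω x)‖ ^ 2 := by
  rw [augLagrangian, penalizedObjective]
  set e := z - blockSum ω x with he
  have h1 : r - T (blockSum ω x) = (r - T z) + T e := by rw [he, map_sub]; abel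
  have h2 : ⟪S (r - T z), e⟫_ℝ = ⟪r - T z, T e⟫_ℝ := by
    rw [real_inner_comm, ← hadj, real_inner_comm]
  rw [h1, h2, norm_add_sq_real]; ring

theorem ADMMStep.norm_slack_le (h : ADMMStep T S r ω α ρ P x x' z z' y y') (hy : y = S (r - T z))
    (hρ : 0 < ρ) (hlam : ∀ v, ‖S (T v)‖ ≤ lam * ‖v‖) :
    ‖z' - blockSum ω x'‖ ≤ lam / ρ * ‖z' - z‖ := by
  have h1 := congrArg norm (h.dual_sub hy)
  rw [norm_smul, norm_neg, Real.norm_of_nonneg hρ.le] at h1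
  rw [div_mul_eq_mul_div, le_div_iff₀ hρ, mul_comm, h1]
  exact hlam _

/-- Replacing, in the partial gradient of the augmented Lagrangian, the mixed state of the sweep by
the final one costs at most a multiple of the step length. -/
theorem ADMMStep.norm_residual_le (h : ADMMStep T S r ω α ρ P x x' z z' y y')
    (hy : y = S (r - T z)) (hρ : 0 < ρ) (hlam0 : 0 ≤ lam) (hlam : ∀ v, ‖S (T v)‖ ≤ lam * ‖v‖)
    (j : ℕ) :
    ‖S (T (blockSum ω x') - r) + (ρ • (z - mixedSum ω x x' j) + y)‖
      ≤ ((lam + ρ) * (1 + lam / ρ) + ρ * ∑ q, |ω q|) * (‖x' - x‖ + ‖z' - z‖) := by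
  set a := blockSum ω x' - z with ha
  have e1 : S (T (blockSum ω x') - r) + (ρ • (z - mixedSum ω x x' j) + y)
      = S (T a) - ρ • a + ρ • (blockSum ω x' - mixedSum ω x x' j) := by
    rw [hy, ha]; simp only [map_sub]; module
  have h1 : ‖a‖ ≤ (1 + lam / ρ) * ‖z' - z‖ := by
    have : a = (z' - z) - (z' - blockSum ω x') := by rw [ha]; abel
    rw [this]
    have := norm_sub_le (z' - z) (z' - blockSum ω x')
    have := h.norm_slack_le hy hρ hlam
    linarith
  have h2 := norm_blockSum_sub_mixedSum_le (ω := ω) (x := x) (x' := x') j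
  have h3 := hlam a
  rw [e1]
  have h4 : ‖S (T a) - ρ • a + ρ • (blockSum ω x' - mixedSum ω x x' j)‖
      ≤ ‖S (T a)‖ + ρ * ‖a‖ + ρ * ‖blockSum ω x' - mixedSum ω x x' j‖ := by
    refine (norm_add_le _ _).trans (add_le_add ((norm_sub_le _ _).trans ?_) ?_)
    · rw [norm_smul, Real.norm_of_nonneg hρ.le]
    · rw [norm_smul, Real.norm_of_nonneg hρ.le]
  have hW : 0 ≤ ∑ q, |ω q| := Finset.sum_nonneg fun q _ => abs_nonneg _
  have h5 : (lam + ρ) * ‖a‖ ≤ (lam + ρ) * ((1 + lam / ρ) * ‖z' - z‖) := by gcongr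
  have h6 : ρ * ‖blockSum ω x' - mixedSum ω x x' j‖ ≤ ρ * ((∑ q, |ω q|) * ‖x' - x‖) := by gcongr
  have h7 : 0 ≤ (lam + ρ) * (1 + lam / ρ) * ‖x' - x‖ := by positivity
  have h8 : 0 ≤ ρ * (∑ q, |ω q|) * ‖z' - z‖ := by positivity
  nlinarith

end

/-! ### The objective gap along the faces -/

section

variable {X Y : Type*} [NormedAddCommGroup X] [InnerProductSpace ℝ X]
  [NormedAddCommGroup Y] [InnerProductSpace ℝ Y] {Q : ℕ}

/-- The derivative of `penalizedObjective` at `x`, as a linear form on `Fin Q → X`. -/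
def penalizedGradient (T : X →ₗ[ℝ] Y) (r : Y) (ω α : Fin Q → ℝ) (x : Fin Q → X) :
    (Fin Q → X) →ₗ[ℝ] ℝ :=
  innerₗ Y (T (blockSum ω x) - r) ∘ₗ T ∘ₗ blockSum ω
    - ∑ q, α q • (innerₗ X (x q) ∘ₗ LinearMap.proj q)

/-- The (constant) second derivative of `penalizedObjective`, as a bilinear form. -/
def penalizedHessian (T : X →ₗ[ℝ] Y) (ω α : Fin Q → ℝ) :
    (Fin Q → X) →ₗ[ℝ] (Fin Q → X) →ₗ[ℝ] ℝ :=
  LinearMap.mk₂ ℝ (fun v w => ⟪T (blockSum ω v), T (blockSum ω w)⟫_ℝ - ∑ q, α q * ⟪v q, w q⟫_ℝ)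
    (fun v v' w => by
      simp only [map_add, inner_add_left, Pi.add_apply, mul_add, Finset.sum_add_distrib]; ring)
    (fun c v w => by
      simp only [map_smul, real_inner_smul_left, Pi.smul_apply, smul_eq_mul, mul_sub,
        Finset.mul_sum]
      congr 1; exact Finset.sum_congr rfl fun q _ => by ring)
    (fun v w w' => by
      simp only [map_add, inner_add_right, Pi.add_apply, mul_add, Finset.sum_add_distrib]; ring)
    (fun c v w => by
      simp only [map_smul, real_inner_smul_right, Pi.smul_apply, smul_eq_mul, mul_sub,
        Finset.mul_sum]
      congr 1; exact Finset.sum_congr rfl fun q _ => by ring)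

variable {T : X →ₗ[ℝ] Y} {S : Y →ₗ[ℝ] X} {r : Y} {ω α : Fin Q → ℝ} {ρ lam : ℝ} {P : X → X}
  {C : Set X}

theorem penalizedGradient_apply (x w : Fin Q → X) :
    penalizedGradient T r ω α x w
      = ⟪T (blockSum ω x) - r, T (blockSum ω w)⟫_ℝ - ∑ q, α q * ⟪x q, w q⟫_ℝ := by
  simp only [penalizedGradient, LinearMap.sub_apply, LinearMap.comp_apply, innerₗ_apply_apply,
    LinearMap.sum_apply, LinearMap.smul_apply, LinearMap.proj_apply, smul_eq_mul]

theorem penalizedGradient_apply_eq_sum (hadj : ∀ x y, ⟪T x, y⟫_ℝ = ⟪x, S y⟫_ℝ) (x w : Fin Q → X) :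
    penalizedGradient T r ω α x w
      = ∑ q, ⟪ω q • S (T (blockSum ω x) - r) - α q • x q, w q⟫_ℝ := by
  have : ⟪T (blockSum ω x) - r, T (blockSum ω w)⟫_ℝ
      = ∑ q, ω q * ⟪S (T (blockSum ω x) - r), w q⟫_ℝ := by
    rw [real_inner_comm, hadj, real_inner_comm, blockSum_apply ω w, inner_sum]
    simp only [real_inner_smul_right]
  rw [penalizedGradient_apply, this, ← Finset.sum_sub_distrib]
  refine Finset.sum_congr rfl fun q _ => ?_
  rw [inner_sub_left, real_inner_smul_left, real_inner_smul_left]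

theorem penalizedObjective_gap_le_on_affine [FiniteDimensional ℝ X] (T : X →ₗ[ℝ] Y) (r : Y)
    (ω α : Fin Q → ℝ) (p : Fin Q → X) (V : Submodule ℝ (Fin Q → X)) :
    ∃ c₀ κ δ : ℝ, 0 ≤ κ ∧ 0 < δ ∧ ∀ x, x - p ∈ V → ∀ ε, 0 ≤ ε → ε < δ →
      (∀ w ∈ V, |penalizedGradient T r ω α x w| ≤ ε * ‖w‖) →
      |penalizedObjective T r ω α x - c₀| ≤ κ * ε ^ 2 := by
  have hgrad : ∀ x, penalizedGradient T r ω α x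
      = penalizedGradient T r ω α 0 + penalizedHessian T ω α x := by
    refine fun x => LinearMap.ext fun w => ?_
    simp only [LinearMap.add_apply, penalizedGradient_apply, penalizedHessian, LinearMap.mk₂_apply,
      inner_sub_left, map_zero, Pi.zero_apply, inner_zero_left, mul_zero, Finset.sum_const_zero]
    ring
  have hobj : ∀ x, penalizedObjective T r ω α x = 1 / 2 * ‖r‖ ^ 2
      + penalizedGradient T r ω α 0 x + 1 / 2 * penalizedHessian T ω α x x := by
    intro x
    simp only [penalizedObjective, penalizedGradient_apply, penalizedHessian,
      LinearMap.mk₂_apply, norm_sub_sq_real, real_inner_self_eq_norm_sq]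
    simp [mul_sub, Finset.mul_sum]
    have : ∀ q, 2⁻¹ * (α q * ‖x q‖ ^ 2) = α q / 2 * ‖x q‖ ^ 2 := fun q => by ring
    simp only [this]; ring
  obtain ⟨c₀, κ, δ, hκ, hδ, h⟩ := quadratic_gap_le_sq_gradient_on_affine (1 / 2 * ‖r‖ ^ 2)
    (penalizedGradient T r ω α 0) (penalizedHessian T ω α)
    (fun v w => by simp only [penalizedHessian, LinearMap.mk₂_apply, real_inner_comm]) p V
  refine ⟨c₀, κ, δ, hκ, hδ, fun x hx ε hε hεδ hw => ?_⟩
  rw [hobj]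
  refine h x hx ε hε hεδ fun w hwV => ?_
  have := hw w hwV
  rwa [hgrad] at this

/-- In directions orthogonal to the normal vectors, such as those of the face that carries `x'`, the
derivative of the objective at `x'` is of the order of the step length. -/
theorem ADMMStep.abs_penalizedGradient_le (hadj : ∀ x y, ⟪T x, y⟫_ℝ = ⟪x, S y⟫_ℝ)
    {x x' : Fin Q → X} {z z' y y' : X} (h : ADMMStep T S r ω α ρ P x x' z z' y y')
    (hy : y = S (r - T z)) (hρ : 0 < ρ) (hlam0 : 0 ≤ lam) (hlam : ∀ v, ‖S (T v)‖ ≤ lam * ‖v‖)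
    (w : Fin Q → X) (hw : ∀ q, ⟪blockNormal ω α ρ x x' z y q, w q⟫_ℝ = 0) :
    |penalizedGradient T r ω α x' w| ≤
      (∑ q, |ω q|) * (((lam + ρ) * (1 + lam / ρ) + ρ * ∑ q, |ω q|) * (‖x' - x‖ + ‖z' - z‖))
        * ‖w‖ := by
  rw [penalizedGradient_apply_eq_sum hadj, Finset.sum_mul, Finset.sum_mul]
  refine (Finset.abs_sum_le_sum_abs _ _).trans (Finset.sum_le_sum fun q _ => ?_)
  have h1 : ⟪ω q • S (T (blockSum ω x') - r) - α q • x' q, w q⟫_ℝ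
      = ω q * ⟪S (T (blockSum ω x') - r) + (ρ • (z - mixedSum ω x x' (q + 1)) + y), w q⟫_ℝ := by
    have := hw q
    rw [blockNormal, inner_add_left, real_inner_smul_left] at this
    rw [inner_sub_left, real_inner_smul_left, inner_add_left]
    linarith
  rw [h1, abs_mul, mul_assoc]
  refine mul_le_mul_of_nonneg_left ((abs_real_inner_le_norm _ _).trans ?_) (abs_nonneg _)
  have hres := h.norm_residual_le hy hρ hlam0 hlam (q + 1)
  exact mul_le_mul hres (norm_le_pi_norm w q) (norm_nonneg _) ((norm_nonneg _).trans hres)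

/-- The gap estimate along the iterates. The hypothesis `hface` encodes that the constraint set is
polyhedral: each value `P w` lies on one of finitely many affine subspaces `p s + V s`, with
`w - P w` orthogonal to `V s`. -/
theorem eventually_penalizedObjective_gap_le [FiniteDimensional ℝ X]
    {ι : Type*} [Finite ι] (p : ι → X) (V : ι → Submodule ℝ X)
    (hface : ∀ w, ∃ s, P w - p s ∈ V s ∧ ∀ v ∈ V s, ⟪w - P w, v⟫_ℝ = 0)
    (hadj : ∀ x y, ⟪T x, y⟫_ℝ = ⟪x, S y⟫_ℝ)
    (hβ : ∀ q, 0 < ω q ^ 2 * ρ - α q) (hρ : 0 < ρ) (hlam0 : 0 ≤ lam)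
    (hlam : ∀ v, ‖S (T v)‖ ≤ lam * ‖v‖)
    {x : ℕ → Fin Q → X} {z y : ℕ → X}
    (hstep : ∀ k, ADMMStep T S r ω α ρ P (x k) (x (k + 1)) (z k) (z (k + 1)) (y k) (y (k + 1)))
    (hy : ∀ k, y k = S (r - T (z k))) {l : ℝ}
    (hN : Tendsto (fun k => ‖x (k + 1) - x k‖ + ‖z (k + 1) - z k‖) atTop (𝓝 0))
    (hF : Tendsto (fun k => penalizedObjective T r ω α (x (k + 1))) atTop (𝓝 l)) :
    ∃ K, 0 ≤ K ∧ ∀ᶠ k in atTop, penalizedObjective T r ω α (x (k + 1)) - l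
      ≤ K * (‖x (k + 1) - x k‖ + ‖z (k + 1) - z k‖) ^ 2 := by
  set N : ℕ → ℝ := fun k => ‖x (k + 1) - x k‖ + ‖z (k + 1) - z k‖ with hNdef
  set M : ℝ := (∑ q, |ω q|) * ((lam + ρ) * (1 + lam / ρ) + ρ * ∑ q, |ω q|) with hM
  have hM0 : 0 ≤ M := by
    have : 0 ≤ ∑ q, |ω q| := Finset.sum_nonneg fun q _ => abs_nonneg _
    positivity
  have hN0 : ∀ k, 0 ≤ N k := fun k => by positivity
  -- the blocks of `x (k + 1)` lie on faces `σ q`, along which the gradient is `O(N k)`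
  have hfaces : ∀ k, ∃ σ : Fin Q → ι, x (k + 1) - (fun q => p (σ q)) ∈
      Submodule.pi Set.univ (fun q => V (σ q)) ∧
      ∀ w ∈ Submodule.pi Set.univ (fun q => V (σ q)),
        |penalizedGradient T r ω α (x (k + 1)) w| ≤ M * N k * ‖w‖ := by
    intro k
    have : ∀ q, ∃ s, x (k + 1) q - p s ∈ V s ∧
        ∀ v ∈ V s, ⟪blockNormal ω α ρ (x k) (x (k + 1)) (z k) (y k) q, v⟫_ℝ = 0 := by
      intro q
      obtain ⟨u, hu, hn⟩ := (hstep k).blockNormal_eq hβ q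
      obtain ⟨s, hs1, hs2⟩ := hface u
      refine ⟨s, hu ▸ hs1, fun v hv => ?_⟩
      rw [hn, real_inner_smul_left, hu, hs2 v hv, mul_zero]
    choose σ hσ1 hσ2 using this
    refine ⟨σ, fun q _ => hσ1 q, fun w hw => ?_⟩
    have := (hstep k).abs_penalizedGradient_le hadj (hy k) hρ hlam0 hlam w
      (fun q => hσ2 q (w q) (hw q trivial))
    rwa [← mul_assoc] at this
  choose σ hσ1 hσ2 using hfaces
  choose c κ δ hκ hδ hgap using fun σ : Fin Q → ι =>
    penalizedObjective_gap_le_on_affine T r ω α (fun q => p (σ q))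
      (Submodule.pi Set.univ (fun q => V (σ q)))
  have hMN : Tendsto (fun k => M * N k) atTop (𝓝 0) := by simpa using hN.const_mul M
  -- a face whose critical value differs from the limit `l` is visited finitely often only
  have hev : ∀ τ, ∀ᶠ k in atTop, σ k = τ →
      |penalizedObjective T r ω α (x (k + 1)) - l| ≤ κ τ * (M * N k) ^ 2 := by
    intro τ
    have hsmall := hMN.eventually (gt_mem_nhds (hδ τ))
    by_cases hc : c τ = l
    · filter_upwards [hsmall] with k hk hkτ
      subst hkτ
      rw [← hc]
      exact hgap _ _ (hσ1 k) _ (mul_nonneg hM0 (hN0 k)) hk (hσ2 k)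
    · have h1 : Tendsto (fun k => |penalizedObjective T r ω α (x (k + 1)) - c τ|
          - κ τ * (M * N k) ^ 2) atTop (𝓝 (|l - c τ| - κ τ * 0 ^ 2)) :=
        ((hF.sub_const _).abs).sub ((hMN.pow 2).const_mul _)
      have h2 : (0 : ℝ) < |l - c τ| - κ τ * 0 ^ 2 := by
        have : 0 < |l - c τ| := abs_pos.2 (sub_ne_zero.2 (Ne.symm hc))
        simpa using this
      filter_upwards [hsmall, h1.eventually (lt_mem_nhds h2)] with k hk hk2 hkτ
      subst hkτ
      have := hgap _ _ (hσ1 k) _ (mul_nonneg hM0 (hN0 k)) hk (hσ2 k)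
      linarith
  have := Fintype.ofFinite (Fin Q → ι)
  refine ⟨(∑ τ, κ τ) * M ^ 2, mul_nonneg (Finset.sum_nonneg fun τ _ => hκ τ) (sq_nonneg _), ?_⟩
  filter_upwards [eventually_all.2 hev] with k hk
  refine (le_abs_self _).trans ((hk _ rfl).trans ?_)
  rw [mul_pow, ← mul_assoc]
  gcongr
  exact Finset.single_le_sum (f := κ) (fun τ _ => hκ τ) (Finset.mem_univ _)

/-! ### Convergence of the iterates -/

/-- Convergence of the whole sequence of iterates to a stationary point. The hypotheses `hy` and
`hx` hold for an arbitrary starting point from the first iterate on. -/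
theorem admm_converges [FiniteDimensional ℝ X]
    {ι : Type*} [Finite ι] (p : ι → X) (V : ι → Submodule ℝ X)
    (hface : ∀ w, ∃ s, P w - p s ∈ V s ∧ ∀ v ∈ V s, ⟪w - P w, v⟫_ℝ = 0)
    (hP : ∀ w, ∀ v ∈ C, ⟪w - P w, v - P w⟫_ℝ ≤ 0)
    (hCc : IsClosed C) (hCb : ∃ R, ∀ v ∈ C, ‖v‖ ≤ R)
    (hadj : ∀ x y, ⟪T x, y⟫_ℝ = ⟪x, S y⟫_ℝ) (hα : ∀ q, 0 ≤ α q)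
    (hβ : ∀ q, 0 < ω q ^ 2 * ρ - α q) (hρ : 0 < ρ) (hlam0 : 0 ≤ lam) (hlamρ : 2 * lam ^ 2 < ρ ^ 2)
    (hT : ∀ v, ‖T v‖ ^ 2 ≤ lam * ‖v‖ ^ 2) (hlam : ∀ v, ‖S (T v)‖ ≤ lam * ‖v‖)
    {x : ℕ → Fin Q → X} {z y : ℕ → X}
    (hstep : ∀ k, ADMMStep T S r ω α ρ P (x k) (x (k + 1)) (z k) (z (k + 1)) (y k) (y (k + 1)))
    (hy : ∀ k, y k = S (r - T (z k))) (hx : ∀ k q, x k q ∈ C) :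
    ∃ (xs : Fin Q → X) (zs ys : X), (∀ q, Tendsto (fun k => x k q) atTop (𝓝 (xs q))) ∧
      Tendsto z atTop (𝓝 zs) ∧ Tendsto y atTop (𝓝 ys) ∧ zs = blockSum ω xs ∧
      (∀ q, xs q ∈ C) ∧ ∀ q, ∀ v ∈ C,
        0 ≤ ⟪ω q • S (T (blockSum ω xs) - r) - α q • xs q, v - xs q⟫_ℝ := by
  set N : ℕ → ℝ := fun k => ‖x (k + 1) - x k‖ + ‖z (k + 1) - z k‖ with hNdef
  have hN0 : ∀ k, 0 ≤ N k := fun k => by positivity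
  set a : ℕ → ℝ := fun k => augLagrangian T r ω α ρ (x k) (z k) (y k) with ha
  have hlamlt : lam < ρ := by nlinarith
  -- sufficient decrease of the augmented Lagrangian
  obtain ⟨c, hc, hdec⟩ : ∃ c, 0 < c ∧ ∀ k, c * N k ^ 2 ≤ a k - a (k + 1) := by
    obtain ⟨m, hm, hmβ⟩ : ∃ m : ℝ, 0 < m ∧ ∀ q, m ≤ ω q ^ 2 * ρ - α q := by
      rcases isEmpty_or_nonempty (Fin Q) with hQ | hQ
      · exact ⟨1, one_pos, fun q => (hQ.false q).elim⟩
      · obtain ⟨q, hq⟩ := Finite.exists_min fun q => ω q ^ 2 * ρ - α q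
        exact ⟨_, hβ q, hq⟩
    have hd : 0 < ρ / 2 - lam ^ 2 / ρ := by
      rw [sub_pos, div_lt_div_iff₀ hρ two_pos]; nlinarith
    set d := ρ / 2 - lam ^ 2 / ρ with hddef
    refine ⟨min (m / 2) d / 2, by positivity, fun k => ?_⟩
    have h1 := (hstep k).primal_descent hβ hP (hx k)
    have h2 := (hstep k).slack_descent hadj (hy k) hρ hlam
    rw [← hddef] at h2
    have h3 : m / 2 * ‖x (k + 1) - x k‖ ^ 2
        ≤ ∑ q, (ω q ^ 2 * ρ - α q) / 2 * ‖x (k + 1) q - x k q‖ ^ 2 := by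
      have h4 : ‖x (k + 1) - x k‖ ≤ √(∑ q, ‖x (k + 1) q - x k q‖ ^ 2) := by
        refine (pi_norm_le_iff_of_nonneg (Real.sqrt_nonneg _)).2 fun q => Real.le_sqrt_of_sq_le ?_
        exact Finset.single_le_sum (f := fun q => ‖x (k + 1) q - x k q‖ ^ 2)
          (fun q _ => sq_nonneg _) (Finset.mem_univ q)
      have h5 : ‖x (k + 1) - x k‖ ^ 2 ≤ ∑ q, ‖x (k + 1) q - x k q‖ ^ 2 :=
        (Real.le_sqrt (norm_nonneg _)
          (Finset.sum_nonneg fun q _ => sq_nonneg _)).1 h4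
      calc m / 2 * ‖x (k + 1) - x k‖ ^ 2 ≤ m / 2 * ∑ q, ‖x (k + 1) q - x k q‖ ^ 2 := by gcongr
        _ ≤ _ := by
          rw [Finset.mul_sum]
          refine Finset.sum_le_sum fun q _ => ?_
          have := hmβ q
          gcongr
    have h6 : min (m / 2) d * ‖x (k + 1) - x k‖ ^ 2 ≤ m / 2 * ‖x (k + 1) - x k‖ ^ 2 := by
      gcongr; exact min_le_left _ _
    have h7 : min (m / 2) d * ‖z (k + 1) - z k‖ ^ 2 ≤ d * ‖z (k + 1) - z k‖ ^ 2 := by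
      gcongr; exact min_le_right _ _
    have h8 : N k ^ 2 ≤ 2 * (‖x (k + 1) - x k‖ ^ 2 + ‖z (k + 1) - z k‖ ^ 2) := by
      simp only [hNdef]; nlinarith [sq_nonneg (‖x (k + 1) - x k‖ - ‖z (k + 1) - z k‖)]
    have h9 : min (m / 2) d / 2 * N k ^ 2 ≤ min (m / 2) d / 2 *
        (2 * (‖x (k + 1) - x k‖ ^ 2 + ‖z (k + 1) - z k‖ ^ 2)) := by gcongr
    simp only [ha]
    linarith
  have hanti : Antitone a :=
    antitone_nat_of_succ_le fun k => by
      have := hdec k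
      have : 0 ≤ c * N k ^ 2 := by positivity
      linarith
  have hlagr : ∀ k, a k = penalizedObjective T r ω α (x k)
      + (ρ / 2 * ‖z k - blockSum ω (x k)‖ ^ 2 - 1 / 2 * ‖T (z k - blockSum ω (x k))‖ ^ 2) := by
    intro k
    simp only [ha]
    rw [hy k, augLagrangian_eq hadj]; ring
  have hFle : ∀ k, penalizedObjective T r ω α (x k) ≤ a k := by
    intro k
    have h1 := hT (z k - blockSum ω (x k))
    have h2 : lam * ‖z k - blockSum ω (x k)‖ ^ 2 ≤ ρ * ‖z k - blockSum ω (x k)‖ ^ 2 := by gcongr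
    rw [hlagr]; linarith
  have hbdd : BddBelow (Set.range a) := by
    obtain ⟨R, hR⟩ := hCb
    refine ⟨-∑ q, α q / 2 * R ^ 2, ?_⟩
    rintro _ ⟨k, rfl⟩
    refine le_trans ?_ (hFle k)
    have h1 : ∑ q, α q / 2 * ‖x k q‖ ^ 2 ≤ ∑ q, α q / 2 * R ^ 2 := by
      refine Finset.sum_le_sum fun q _ => ?_
      have := hα q
      have := hR _ (hx k q)
      gcongr
    rw [penalizedObjective]
    have : 0 ≤ 1 / 2 * ‖r - T (blockSum ω (x k))‖ ^ 2 := by positivity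
    linarith
  have hlim := tendsto_atTop_ciInf hanti hbdd
  set l := ⨅ k, a k with hl
  have hlle : ∀ k, l ≤ a k := fun k => ciInf_le hbdd k
  have hNlim : Tendsto N atTop (𝓝 0) := by
    have h1 : Tendsto (fun k => (a k - a (k + 1)) / c) atTop (𝓝 0) := by
      have := (hlim.sub (hlim.comp (tendsto_add_atTop_nat 1))).div_const c
      simpa using this
    have h2 : Tendsto (fun k => N k ^ 2) atTop (𝓝 0) := by
      refine squeeze_zero (fun k => sq_nonneg _) (fun k => ?_) h1
      rw [le_div_iff₀ hc]; linarith [hdec k]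
    have h3 := h2.sqrt
    simpa [Real.sqrt_sq (hN0 _)] using h3
  have hslack : ∀ k, ‖z (k + 1) - blockSum ω (x (k + 1))‖ ≤ lam / ρ * N k := by
    intro k
    refine ((hstep k).norm_slack_le (hy k) hρ hlam).trans ?_
    gcongr
    exact le_add_of_nonneg_left (norm_nonneg _)
  have hgapL : ∀ k, a (k + 1) - penalizedObjective T r ω α (x (k + 1))
      ≤ ρ / 2 * (lam / ρ) ^ 2 * N k ^ 2 := by
    intro k
    have h1 : ‖z (k + 1) - blockSum ω (x (k + 1))‖ ^ 2 ≤ (lam / ρ * N k) ^ 2 :=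
      pow_le_pow_left₀ (norm_nonneg _) (hslack k) 2
    have h2 := sq_nonneg ‖T (z (k + 1) - blockSum ω (x (k + 1)))‖
    have h3 : ρ / 2 * ‖z (k + 1) - blockSum ω (x (k + 1))‖ ^ 2 ≤ ρ / 2 * (lam / ρ * N k) ^ 2 := by
      gcongr
    rw [hlagr]
    rw [mul_pow] at h3
    linarith
  have hF : Tendsto (fun k => penalizedObjective T r ω α (x (k + 1))) atTop (𝓝 l) := by
    have h1 := hlim.comp (tendsto_add_atTop_nat 1)
    have h2 : Tendsto (fun k => a (k + 1) - ρ / 2 * (lam / ρ) ^ 2 * N k ^ 2) atTop (𝓝 l) := by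
      simpa using h1.sub ((hNlim.pow 2).const_mul (ρ / 2 * (lam / ρ) ^ 2))
    exact tendsto_of_tendsto_of_tendsto_of_le_of_le h2 h1
      (fun k => by linarith [hgapL k]) (fun k => hFle (k + 1))
  obtain ⟨K, hK, hgap⟩ := eventually_penalizedObjective_gap_le p V hface hadj hβ hρ hlam0 hlam
    hstep hy hNlim hF
  have hsum : Summable N := by
    refine summable_of_descent (K := ρ / 2 * (lam / ρ) ^ 2 + K) hc (by positivity) hN0 hdec hlle ?_
    filter_upwards [hgap] with k hk
    linarith [hgapL k]
  have hcauchy : CauchySeq x := by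
    refine cauchySeq_of_summable_dist (Summable.of_nonneg_of_le (fun _ => dist_nonneg)
      (fun k => ?_) hsum)
    rw [dist_comm, dist_eq_norm]
    exact le_add_of_nonneg_right (norm_nonneg _)
  have : CompleteSpace X := FiniteDimensional.complete ℝ X
  obtain ⟨xs, hxs⟩ := cauchySeq_tendsto_of_complete hcauchy
  have hxsq : ∀ q, Tendsto (fun k => x k q) atTop (𝓝 (xs q)) := tendsto_pi_nhds.1 hxs
  have hbc : Continuous (blockSum ω : (Fin Q → X) → X) :=
    LinearMap.continuous_of_finiteDimensional _
  have hblock : Tendsto (fun k => blockSum ω (x k)) atTop (𝓝 (blockSum ω xs)) :=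
    (hbc.tendsto xs).comp hxs
  have hzs : Tendsto z atTop (𝓝 (blockSum ω xs)) := by
    refine (tendsto_add_atTop_iff_nat 1).1 ?_
    have h1 : Tendsto (fun k => z (k + 1) - blockSum ω (x (k + 1))) atTop (𝓝 0) :=
      squeeze_zero_norm hslack (by simpa using hNlim.const_mul (lam / ρ))
    simpa using h1.add (hblock.comp (tendsto_add_atTop_nat 1))
  have hST : Continuous fun v => S (T v) :=
    LinearMap.continuous_of_finiteDimensional (S ∘ₗ T)
  have hys : Tendsto y atTop (𝓝 (S (r - T (blockSum ω xs)))) := by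
    have : y = fun k => S r - S (T (z k)) := by funext k; rw [hy, map_sub]
    rw [this, map_sub]
    exact tendsto_const_nhds.sub ((hST.tendsto _).comp hzs)
  refine ⟨xs, _, _, hxsq, hzs, hys, rfl,
    fun q => hCc.mem_of_tendsto (hxsq q) (Eventually.of_forall fun k => hx k q), fun q v hv => ?_⟩
  have hx1 := (hxsq q).comp (tendsto_add_atTop_nat 1)
  have hmixed : Tendsto (fun k => mixedSum ω (x k) (x (k + 1)) (q + 1)) atTop
      (𝓝 (blockSum ω xs)) := by
    have h1 : Tendsto (fun k => blockSum ω (x (k + 1)) - mixedSum ω (x k) (x (k + 1)) (q + 1))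
        atTop (𝓝 0) := by
      refine squeeze_zero_norm (a := fun k => (∑ q, |ω q|) * N k) (fun k => ?_)
        (by simpa using hNlim.const_mul (∑ q, |ω q|))
      refine (norm_blockSum_sub_mixedSum_le _).trans ?_
      have : 0 ≤ ∑ q, |ω q| := Finset.sum_nonneg fun q _ => abs_nonneg _
      gcongr
      exact le_add_of_nonneg_right (norm_nonneg _)
    simpa using (hblock.comp (tendsto_add_atTop_nat 1)).sub h1
  have hnormal : Tendsto (fun k => blockNormal ω α ρ (x k) (x (k + 1)) (z k) (y k) q) atTop
      (𝓝 (ω q • (ρ • (blockSum ω xs - blockSum ω xs) + S (r - T (blockSum ω xs)))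
        + α q • xs q)) :=
    ((((hzs.sub hmixed).const_smul ρ).add hys).const_smul (ω q)).add (hx1.const_smul (α q))
  have hle := le_of_tendsto (hnormal.inner (tendsto_const_nhds.sub hx1))
    (Eventually.of_forall fun k => (hstep k).inner_blockNormal_nonpos hβ hP q hv)
  have heq : ω q • S (T (blockSum ω xs) - r) - α q • xs q
      = -(ω q • (ρ • (blockSum ω xs - blockSum ω xs) + S (r - T (blockSum ω xs)))
        + α q • xs q) := by
    simp only [map_sub]; module
  rw [heq, inner_neg_left]
  linarith

end

/-! ### The box and its faces -/

theorem inner_eq_sum_re_im {U : ℕ} (v w : CVec U) :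
    ⟪v, w⟫_ℝ = ∑ u, ((v u).re * (w u).re + (v u).im * (w u).im) := by
  rw [PiLp.inner_apply]
  refine Finset.sum_congr rfl fun u _ => ?_
  rw [Complex.inner]
  simp; ring

theorem inner_complex_re {U : ℕ} (v w : CVec U) : (inner ℂ v w).re = ⟪v, w⟫_ℝ := by
  rw [inner_eq_sum_re_im, PiLp.inner_apply, Complex.re_sum]
  refine Finset.sum_congr rfl fun u _ => ?_
  simp; ring

theorem boxProj_mem {U : ℕ} (w : CVec U) : boxProj w ∈ box U := by
  intro u
  simp [boxProj]

theorem sub_clip_mul_nonpos {a b : ℝ} (hb : b ∈ Set.Icc (-1 : ℝ) 1) :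
    (a - max (-1) (min 1 a)) * (b - max (-1) (min 1 a)) ≤ 0 := by
  obtain ⟨h1, h2⟩ := hb
  rcases le_total a 1 with h | h
  · rw [min_eq_right h]
    rcases le_total a (-1) with h' | h'
    · rw [max_eq_left h']; nlinarith
    · rw [max_eq_right h']; simp
  · rw [min_eq_left h, max_eq_right (by norm_num)]; nlinarith

theorem inner_sub_boxProj_nonpos {U : ℕ} (w : CVec U) {v : CVec U} (hv : v ∈ box U) :
    ⟪w - boxProj w, v - boxProj w⟫_ℝ ≤ 0 := by
  rw [inner_eq_sum_re_im]
  exact Finset.sum_nonpos fun u _ =>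
    add_nonpos (sub_clip_mul_nonpos (hv u).1) (sub_clip_mul_nonpos (hv u).2)

/-- A clipped number is either at the bound `s = ±1`, or clipping does not change it (`s = 0`). -/
theorem exists_sign_clip (a : ℝ) : ∃ s : SignType,
    (s ≠ 0 → max (-1) (min 1 a) = (s : ℝ)) ∧ (s = 0 → a = max (-1) (min 1 a)) := by
  rcases le_total a 1 with h | h
  · rcases le_total a (-1) with h' | h'
    · exact ⟨-1, by simp [min_eq_right h, max_eq_left h'], by simp⟩
    · exact ⟨0, by simp, by simp [min_eq_right h, max_eq_right h']⟩
  · exact ⟨1, by simp [min_eq_left h], by simp⟩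

/-- The base point of the face of the box given by the sign pattern `s`: the entries of `s` for real
and imaginary parts are `±1` where a coordinate is fixed at that bound and `0` where it is free. -/
def faceBase {U : ℕ} (s : Fin U → SignType × SignType) : CVec U :=
  WithLp.toLp 2 fun u => (⟨((s u).1 : ℝ), ((s u).2 : ℝ)⟩ : ℂ)

/-- The direction space of the face given by the sign pattern `s`. -/
def faceDirection {U : ℕ} (s : Fin U → SignType × SignType) : Submodule ℝ (CVec U) where
  carrier := {v | ∀ u, ((s u).1 ≠ 0 → (v u).re = 0) ∧ ((s u).2 ≠ 0 → (v u).im = 0)}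
  add_mem' {v w} hv hw u := by
    refine ⟨fun h => ?_, fun h => ?_⟩
    · simp [(hv u).1 h, (hw u).1 h]
    · simp [(hv u).2 h, (hw u).2 h]
  zero_mem' u := by simp
  smul_mem' c v hv u := by
    refine ⟨fun h => ?_, fun h => ?_⟩
    · simp [(hv u).1 h]
    · simp [(hv u).2 h]

theorem exists_face_boxProj {U : ℕ} (w : CVec U) : ∃ s : Fin U → SignType × SignType,
    boxProj w - faceBase s ∈ faceDirection s ∧
      ∀ v ∈ faceDirection s, ⟪w - boxProj w, v⟫_ℝ = 0 := by
  choose s hs hs' using fun u => exists_sign_clip (w u).re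
  choose t ht ht' using fun u => exists_sign_clip (w u).im
  refine ⟨fun u => (s u, t u), fun u => ⟨fun h => ?_, fun h => ?_⟩, fun v hv => ?_⟩
  · exact sub_eq_zero.2 (hs u h)
  · exact sub_eq_zero.2 (ht u h)
  · rw [inner_eq_sum_re_im]
    refine Finset.sum_eq_zero fun u _ => ?_
    have h1 : (w u - boxProj w u).re * (v u).re = 0 := by
      by_cases h : s u = 0
      · rw [show (w u - boxProj w u).re = 0 from sub_eq_zero.2 (hs' u h), zero_mul]
      · rw [(hv u).1 h, mul_zero]
    have h2 : (w u - boxProj w u).im * (v u).im = 0 := by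
      by_cases h : t u = 0
      · rw [show (w u - boxProj w u).im = 0 from sub_eq_zero.2 (ht' u h), zero_mul]
      · rw [(hv u).2 h, mul_zero]
    exact (congrArg₂ (· + ·) h1 h2).trans (add_zero 0)

theorem isClosed_box (U : ℕ) : IsClosed (box U) := by
  have : box U = ⋂ u, {x : CVec U | (x u).re ∈ Set.Icc (-1 : ℝ) 1} ∩
      {x : CVec U | (x u).im ∈ Set.Icc (-1 : ℝ) 1} := by
    ext x; simp [box]
  rw [this]
  refine isClosed_iInter fun u => IsClosed.inter ?_ ?_
  · exact isClosed_Icc.preimage (by fun_prop)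
  · exact isClosed_Icc.preimage (by fun_prop)

theorem norm_le_of_mem_box {U : ℕ} {v : CVec U} (hv : v ∈ box U) : ‖v‖ ≤ √(U * 2) := by
  refine Real.le_sqrt_of_sq_le ?_
  rw [← real_inner_self_eq_norm_sq, inner_eq_sum_re_im]
  have : ∀ u ∈ Finset.univ, (v u).re * (v u).re + (v u).im * (v u).im ≤ 2 := by
    intro u _
    obtain ⟨⟨h1, h2⟩, h3, h4⟩ := hv u
    nlinarith
  simpa using Finset.sum_le_card_nsmul _ _ _ this

/-! ### The real-linear map of a complex matrix -/

section

variable {B U Q : ℕ} (H : Matrix (Fin B) (Fin U) ℂ)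

/-- A complex matrix as a real-linear map, adjoints being taken for the real inner product
`Re ⟪·, ·⟫`. -/
def realLin {m n : ℕ} (A : Matrix (Fin m) (Fin n) ℂ) : CVec n →ₗ[ℝ] CVec m :=
  A.toEuclideanLin.restrictScalars ℝ

theorem inner_realLin (v : CVec U) (w : CVec B) :
    ⟪realLin H v, w⟫_ℝ = ⟪v, realLin H.conjTranspose w⟫_ℝ := by
  rw [← inner_complex_re, ← inner_complex_re]
  simp only [realLin, LinearMap.coe_restrictScalars]
  rw [Matrix.toEuclideanLin_conjTranspose_eq_adjoint, LinearMap.adjoint_inner_right]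

theorem realLin_conjTranspose_mul (v : CVec U) :
    realLin H.conjTranspose (realLin H v) = (H.conjTranspose * H).toEuclideanLin v := by
  simp [realLin, Matrix.toEuclideanLin, Matrix.toLpLin_mul (q := 2)]

open scoped ComplexOrder in
theorem lambdaMax_nonneg :
    0 ≤ lambdaMax (Matrix.isHermitian_conjTranspose_mul_self H) :=
  Real.iSup_nonneg fun i =>
    (Matrix.posSemidef_conjTranspose_mul_self H).eigenvalues_nonneg i

theorem norm_realLin_sq_le (v : CVec U) :
    ‖realLin H v‖ ^ 2 ≤ lambdaMax (Matrix.isHermitian_conjTranspose_mul_self H) * ‖v‖ ^ 2 := by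
  set hA := Matrix.isHermitian_conjTranspose_mul_self H
  set b := hA.eigenvectorBasis with hb
  have h1 : ‖realLin H v‖ ^ 2 = (inner ℂ v ((H.conjTranspose * H).toEuclideanLin v)).re := by
    rw [← real_inner_self_eq_norm_sq, inner_realLin, realLin_conjTranspose_mul, inner_complex_re]
  have h2 : ∀ i, inner ℂ (b i) ((H.conjTranspose * H).toEuclideanLin v)
      = hA.eigenvalues i * inner ℂ (b i) v := by
    intro i
    have hsym : inner ℂ (b i) ((H.conjTranspose * H).toEuclideanLin v)
        = inner ℂ ((H.conjTranspose * H).toEuclideanLin (b i)) v := by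
      rw [← LinearMap.adjoint_inner_left, ← Matrix.toEuclideanLin_conjTranspose_eq_adjoint, hA.eq]
    have heig : (H.conjTranspose * H).toEuclideanLin (b i) = (hA.eigenvalues i : ℂ) • b i := by
      ext u
      have := congrFun (hA.mulVec_eigenvectorBasis i) u
      simpa [Matrix.toEuclideanLin, Matrix.toLpLin_apply] using this
    rw [hsym, heig, inner_smul_left]
    simp
  rw [h1, ← b.sum_inner_mul_inner, Complex.re_sum, ← b.sum_sq_norm_inner_right v, Finset.mul_sum]
  refine Finset.sum_le_sum fun i _ => ?_
  have h3 : (inner ℂ v (b i) * inner ℂ (b i) ((H.conjTranspose * H).toEuclideanLin v)).re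
      = hA.eigenvalues i * ‖inner ℂ (b i) v‖ ^ 2 := by
    rw [h2, ← inner_conj_symm v (b i), mul_left_comm, ← Complex.normSq_eq_conj_mul_self,
      Complex.normSq_eq_norm_sq, ← Complex.ofReal_mul, Complex.ofReal_re]
  rw [h3]
  gcongr
  exact le_ciSup (Set.finite_range _).bddAbove i

theorem norm_realLin_conjTranspose_le (v : CVec U) :
    ‖realLin H.conjTranspose (realLin H v)‖
      ≤ lambdaMax (Matrix.isHermitian_conjTranspose_mul_self H) * ‖v‖ := by
  set lam := lambdaMax (Matrix.isHermitian_conjTranspose_mul_self H)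
  have hlam : 0 ≤ lam := lambdaMax_nonneg H
  set g := realLin H.conjTranspose (realLin H v) with hg
  have h1 : ‖g‖ ^ 2 ≤ ‖realLin H g‖ * ‖realLin H v‖ := by
    rw [← real_inner_self_eq_norm_sq]
    nth_rewrite 2 [hg]
    rw [← inner_realLin]
    exact real_inner_le_norm _ _
  have h2 : (‖realLin H g‖ * ‖realLin H v‖) ^ 2 ≤ (lam * ‖g‖ ^ 2) * (lam * ‖v‖ ^ 2) := by
    rw [mul_pow]
    have := norm_realLin_sq_le H g
    have := norm_realLin_sq_le H v
    gcongr
  have h3 : ‖realLin H g‖ * ‖realLin H v‖ ≤ ‖g‖ * (lam * ‖v‖) :=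
    abs_le_of_sq_le_sq' (h2.trans_eq (by ring)) (by positivity) |>.2
  rcases (norm_nonneg g).eq_or_lt with h | h
  · rw [← h]; positivity
  · exact le_of_mul_le_mul_left ((sq ‖g‖).symm.trans_le (h1.trans h3)) h

open scoped ComplexOrder in
/-- The matrix inverse in the `x_0`-step is a genuine inverse, because `HᴴH + ρ I` is positive
definite. -/
theorem gram_add_smul_nonsing {ρ : ℝ} (hρ : 0 < ρ) (v : CVec U) :
    realLin H.conjTranspose (realLin H (((H.conjTranspose * H +
        (ρ : ℂ) • (1 : Matrix (Fin U) (Fin U) ℂ))⁻¹).toEuclideanLin v))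
      + ρ • ((H.conjTranspose * H +
        (ρ : ℂ) • (1 : Matrix (Fin U) (Fin U) ℂ))⁻¹).toEuclideanLin v = v := by
  set A := H.conjTranspose * H + (ρ : ℂ) • (1 : Matrix (Fin U) (Fin U) ℂ) with hA
  have hpos : A.PosDef := by
    refine Matrix.PosDef.posSemidef_add (Matrix.posSemidef_conjTranspose_mul_self H) ?_
    exact Matrix.PosDef.one.smul (by exact_mod_cast hρ)
  have hinv : A * A⁻¹ = 1 :=
    Matrix.mul_nonsing_inv _ ((Matrix.isUnit_iff_isUnit_det _).1 hpos.isUnit)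
  set w := A⁻¹.toEuclideanLin v with hw
  have h1 : A.toEuclideanLin w = v := by
    have : (A * A⁻¹).toEuclideanLin v = A.toEuclideanLin w := by
      simp [hw, Matrix.toEuclideanLin, Matrix.toLpLin_mul (q := 2)]
    rw [← this, hinv]
    simp [Matrix.toEuclideanLin]
  rw [realLin_conjTranspose_mul]
  conv_rhs => rw [← h1]
  rw [hA, map_add, map_smul]
  simp [Matrix.toEuclideanLin]

/-! ### The objective of the problem -/

theorem weightedSum_eq_blockSum (x : Fin Q → CVec U) :
    weightedSum x = blockSum (fun q : Fin Q => (2 : ℝ) ^ (q : ℕ)) x := by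
  rw [blockSum_apply, weightedSum]

theorem hasGradientAt_objective_update (r : CVec B) (α : Fin Q → ℝ) (x : Fin Q → CVec U)
    (q : Fin Q) :
    HasGradientAt (fun z : CVec U => objective H r α (Function.update x q z))
      ((2 : ℝ) ^ (q : ℕ) • realLin H.conjTranspose (realLin H (weightedSum x) - r) - α q • x q)
      (x q) := by
  set ω : Fin Q → ℝ := fun q => (2 : ℝ) ^ (q : ℕ) with hω
  set L : CVec U →L[ℝ] CVec B := LinearMap.toContinuousLinearMap (realLin H) with hL
  have hs : ∀ z, weightedSum (Function.update x q z) = weightedSum x + ω q • (z - x q) := by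
    intro z
    have : Function.update x q z = x + Pi.single q (z - x q) := by
      ext1 i
      by_cases h : i = q
      · subst h; simp
      · simp [h]
    rw [weightedSum_eq_blockSum, weightedSum_eq_blockSum, this, map_add]
    congr 1
    rw [blockSum_apply, Finset.sum_eq_single q]
    · simp [hω]
    · intro i _ hi; simp [hi]
    · simp
  have hobj : (fun z : CVec U => objective H r α (Function.update x q z)) = fun z =>
      1 / 2 * ‖r - L (weightedSum x + ω q • (z - x q))‖ ^ 2
        - (α q / 2 * ‖z‖ ^ 2 + ∑ i ∈ Finset.univ.erase q, α i / 2 * ‖x i‖ ^ 2) := by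
    funext z
    rw [objective, hs, loss, ← Finset.add_sum_erase _ _ (Finset.mem_univ q)]
    congr 2
    · simp
    · refine Finset.sum_congr rfl fun i hi => ?_
      rw [Function.update_of_ne (Finset.ne_of_mem_erase hi)]
  rw [hobj, hasGradientAt_iff_hasFDerivAt]
  have hid : HasFDerivAt (fun z : CVec U => z) (ContinuousLinearMap.id ℝ (CVec U)) (x q) :=
    hasFDerivAt_id _
  have h1 : HasFDerivAt (fun z : CVec U => r - L (weightedSum x + ω q • (z - x q)))
      (-(L ∘L (ω q • ContinuousLinearMap.id ℝ (CVec U)))) (x q) :=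
    (L.hasFDerivAt.comp (x q) (((hid.sub_const (x q)).const_smul (ω q)).const_add
      (weightedSum x))).const_sub r
  have h2 := (h1.norm_sq.const_mul (1 / 2)).sub
    ((hid.norm_sq.const_mul (α q / 2)).add_const
      (∑ i ∈ Finset.univ.erase q, α i / 2 * ‖x i‖ ^ 2))
  refine h2.congr_fderiv ?_
  ext v
  have h3 : ⟪realLin H.conjTranspose (realLin H (weightedSum x) - r), v⟫_ℝ
      = ⟪realLin H (weightedSum x) - r, realLin H v⟫_ℝ := by
    rw [real_inner_comm, ← inner_realLin, real_inner_comm]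
  rw [map_sub, inner_sub_left, inner_sub_left] at h3
  simp [hL]
  rw [h3]
  simp only [hω]
  ring

end

end PSADMM

theorem theorem1 {B U Q : ℕ} (H : Matrix (Fin B) (Fin U) ℂ) (r : PSADMM.CVec B)
    (ρ : ℝ) (α : Fin Q → ℝ) (hα : ∀ q, 0 ≤ α q)
    (hρα : ∀ q : Fin Q, α q < 4 ^ (q : ℕ) * ρ)
    (hρ : Real.sqrt 2 * PSADMM.lambdaMax (Matrix.isHermitian_conjTranspose_mul_self H) < ρ)
    (x : ℕ → Fin Q → PSADMM.CVec U) (x₀ y : ℕ → PSADMM.CVec U)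
    (hxy : PSADMM.IsPSADMM H r ρ α x x₀ y) :
    ∃ (xs : Fin Q → PSADMM.CVec U) (x₀s ys : PSADMM.CVec U),
      (∀ q, Tendsto (fun k => x k q) atTop (𝓝 (xs q))) ∧
      Tendsto x₀ atTop (𝓝 x₀s) ∧
      Tendsto y atTop (𝓝 ys) ∧
      x₀s = PSADMM.weightedSum xs ∧
      PSADMM.IsStationary H r α xs := by
  set lam := PSADMM.lambdaMax (Matrix.isHermitian_conjTranspose_mul_self H) with hlam
  have hlam0 : 0 ≤ lam := PSADMM.lambdaMax_nonneg H
  have hρ0 : 0 < ρ := lt_of_le_of_lt (by positivity) hρ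
  have hlamρ : 2 * lam ^ 2 < ρ ^ 2 := by
    have h1 := pow_lt_pow_left₀ hρ (by positivity) two_ne_zero
    rwa [mul_pow, Real.sq_sqrt zero_le_two] at h1
  set ω : Fin Q → ℝ := fun q => (2 : ℝ) ^ (q : ℕ) with hω
  have hω2 : ∀ q, ω q ^ 2 = 4 ^ (q : ℕ) := fun q => by
    rw [hω, ← pow_mul, mul_comm, pow_mul]; norm_num
  have hβ : ∀ q, 0 < ω q ^ 2 * ρ - α q := fun q => by
    rw [hω2]; linarith [hρα q]
  have hstep : ∀ k, PSADMM.ADMMStep (PSADMM.realLin H) (PSADMM.realLin H.conjTranspose) r ω α ρ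
      PSADMM.boxProj (x k) (x (k + 1)) (x₀ k) (x₀ (k + 1)) (y k) (y (k + 1)) := by
    intro k
    refine ⟨fun q => ?_, ?_, ?_⟩
    · rw [hω2]; exact hxy.x_step k q
    · rw [hxy.x₀_step k, PSADMM.gram_add_smul_nonsing H hρ0, PSADMM.weightedSum_eq_blockSum]
      rfl
    · rw [hxy.y_step k, PSADMM.weightedSum_eq_blockSum]
  -- the sequences are shifted by one: the starting point need not lie in the box, and `y` is a
  -- function of `x₀` only after the first step
  obtain ⟨xs, zs, ys, hx, hz, hy, hzs, hmem, hvi⟩ := PSADMM.admm_converges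
    PSADMM.faceBase PSADMM.faceDirection PSADMM.exists_face_boxProj
    (fun w v hv => PSADMM.inner_sub_boxProj_nonpos w hv)
    (PSADMM.isClosed_box U)
    ⟨_, fun v hv => PSADMM.norm_le_of_mem_box hv⟩
    (PSADMM.inner_realLin H) hα hβ hρ0 hlam0 hlamρ (PSADMM.norm_realLin_sq_le H)
    (PSADMM.norm_realLin_conjTranspose_le H)
    (x := fun k => x (k + 1)) (z := fun k => x₀ (k + 1)) (y := fun k => y (k + 1))
    (fun k => hstep (k + 1)) (fun k => (hstep k).y_eq)
    (fun k q => by rw [hxy.x_step k q]; exact PSADMM.boxProj_mem _)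
  refine ⟨xs, zs, ys, fun q => (tendsto_add_atTop_iff_nat (f := fun k => x k q) 1).1 (hx q),
    (tendsto_add_atTop_iff_nat 1).1 hz, (tendsto_add_atTop_iff_nat 1).1 hy,
    hzs.trans (PSADMM.weightedSum_eq_blockSum xs).symm, hmem, fun q =>
    ⟨_, PSADMM.hasGradientAt_objective_update H r α xs q, fun v hv => ?_⟩⟩
  rw [PSADMM.inner_complex_re, PSADMM.weightedSum_eq_blockSum]
  exact hvi q v hv

end
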